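/- Conventions. An operator space is a complex Banach space $E$ equipped with norms $\|\cdot\|_n$ on the matrix spaces $M_n(E)$ ($\|\cdot\|_1$ being the norm of $E$) satisfying Ruan's axioms $\|axb\|_m\le\|a\|\,\|x\|_n\,\|b\|$ for $a\in M_{m,n}(\mathbb C)$, $x\in M_n(E)$, $b\in M_{n,m}(\mathbb C)$, and $\|x\oplus y\|_{m+n}=\max(\|x\|_m,\|y\|_n)$. $CB(E,F)$ is the space of completely bounded linear maps with the norm $\|\cdot\|_{cb}$, $CB(E)=CB(E,E)$, and the dual $E^*$ carries its standard operator space structure $M_n(E^*)=CB(E,M_n(\mathbb C))$. The space $E$ is locally reflexive if for every finite-dimensional operator space $L$ the natural linear isomorphism $CB(L,E^{**})\to CB(L,E)^{**}$ is isometric. An operator ideal norm $\alpha$ assigns to every $T\in CB(E,F)$, for all operator spaces $E,F$, a value $\alpha(T)\in[0,\infty]$ such that $\|T\|_{cb}\le\alpha(T)$, $\alpha(S+T)\le\alpha(S)+\alpha(T)$, $\alpha(cT)=|c|\,\alpha(T)$ for $c\in\mathbb C$, and $\alpha(RTS)\le\|R\|_{cb}\,\alpha(T)\,\|S\|_{cb}$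 for all completely bounded $R,S$ for which the composition is defined (with $0\cdot\infty=0$). Its dual is $\alpha^d(T)=\alpha(T^*)$. It is 1-injective if $\alpha(T)=\alpha(i\circ T)$ for every $T\in CB(E,F)$ and every completely isometric inclusion $i:F\hookrightarrow G$. Let $\beta$ be $\alpha$ or $\alpha^d$, let $K\ge 1$ be a constant and $k:\mathbb N\to[0,\infty)$ a function. $E$ has the $(K,k(n))$-$\beta$-OUAP if for every $n$ and every $n$-dimensional subspace $M\subset E$ there is a finite rank operator $T\in CB(E)$ with $\|T\|_{cb}\le K$, $\beta(T)\le k(n)$ and $T|_M=\mathrm{id}_M$. Lemma. Let $\alpha$ be a 1-injective operator ideal norm. If $E$ is a locally reflexive operator space and $E^*$ has the $(K,k(n))$-$\alpha^d$-OUAP, then $E$ has the $(K(1+\varepsilon),\,k(n)(1+\varepsilon))$-$\alpha$-OUAP for every $\varepsilon>0$. -/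

import Mathlib

open scoped NNReal ENNReal

universe u

noncomputable section

namespace OpSpace

open scoped Matrix.Norms.L2Operator

/-! ### Operator spaces

Complex matrices carry the operator norm between Euclidean spaces throughout. -/

/-- The product `a x b` of a matrix `x` over `E` with scalar matrices `a`, `b`. -/
def sandwich {E : Type*} [AddCommGroup E] [Module ℂ E] {m n : ℕ}
    (a : Matrix (Fin m) (Fin n) ℂ) (x : Matrix (Fin n) (Fin n) E)
    (b : Matrix (Fin n) (Fin m) ℂ) : Matrix (Fin m) (Fin m) E :=
  Matrix.of fun i j => ∑ k, ∑ l, (a i k * b l j) • x k l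

/-- The block diagonal matrix `x ⊕ y`. -/
def directSum {E : Type*} [AddCommGroup E] {m n : ℕ}
    (x : Matrix (Fin m) (Fin m) E) (y : Matrix (Fin n) (Fin n) E) :
    Matrix (Fin (m + n)) (Fin (m + n)) E :=
  Matrix.reindex finSumFinEquiv finSumFinEquiv (Matrix.fromBlocks x 0 0 y)

/-- A (complete) operator space structure on the complex Banach space `E`: norms on all the
matrix spaces `M_n(E)`, extending the norm of `E = M_1(E)` and satisfying Ruan's axioms. -/
class OperatorSpace (E : Type u) [NormedAddCommGroup E] [NormedSpace ℂ E] : Type u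
    extends CompleteSpace E where
  matNorm : (n : ℕ) → Matrix (Fin n) (Fin n) E → ℝ
  matNorm_one : ∀ x : E, matNorm 1 (Matrix.of fun _ _ => x) = ‖x‖
  matNorm_add_le : ∀ (n : ℕ) (x y : Matrix (Fin n) (Fin n) E),
    matNorm n (x + y) ≤ matNorm n x + matNorm n y
  matNorm_smul : ∀ (n : ℕ) (c : ℂ) (x : Matrix (Fin n) (Fin n) E),
    matNorm n (c • x) = ‖c‖ * matNorm n x
  eq_zero_of_matNorm : ∀ (n : ℕ) (x : Matrix (Fin n) (Fin n) E), matNorm n x = 0 → x = 0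
  matNorm_sandwich_le : ∀ (m n : ℕ) (a : Matrix (Fin m) (Fin n) ℂ)
    (x : Matrix (Fin n) (Fin n) E) (b : Matrix (Fin n) (Fin m) ℂ),
    matNorm m (sandwich a x b) ≤ ‖a‖ * matNorm n x * ‖b‖
  matNorm_directSum : ∀ (m n : ℕ) (x : Matrix (Fin m) (Fin m) E)
    (y : Matrix (Fin n) (Fin n) E),
    matNorm (m + n) (directSum x y) = max (matNorm m x) (matNorm n y)

open OperatorSpace

section Scalar

variable {ι κ : Type*} [Fintype ι] [Fintype κ]

/-- The Euclidean norm of a tuple of complex numbers. -/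
def nv (v : ι → ℂ) : ℝ := ‖WithLp.toLp 2 v‖

theorem nv_nonneg (v : ι → ℂ) : 0 ≤ nv v := norm_nonneg _

theorem nv_sq (v : ι → ℂ) : nv v ^ 2 = ∑ i, ‖v i‖ ^ 2 := by
  simp [nv, EuclideanSpace.norm_sq_eq]

theorem nv_le_of_sq {v : ι → ℂ} {C : ℝ} (hC : 0 ≤ C) (h : ∑ i, ‖v i‖ ^ 2 ≤ C ^ 2) : nv v ≤ C := by
  rw [← nv_sq] at h
  exact (sq_le_sq₀ (nv_nonneg v) hC).1 h

theorem nv_mulVec_le [DecidableEq κ] (A : Matrix ι κ ℂ) (v : κ → ℂ) :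
    nv (A.mulVec v) ≤ ‖A‖ * nv v :=
  Matrix.l2_opNorm_mulVec A (WithLp.toLp 2 v)

theorem norm_le_of_mulVec [DecidableEq κ] (A : Matrix ι κ ℂ) {C : ℝ} (hC : 0 ≤ C)
    (h : ∀ v, nv (A.mulVec v) ≤ C * nv v) : ‖A‖ ≤ C := by
  rw [Matrix.l2_opNorm_def]
  exact ContinuousLinearMap.opNorm_le_bound _ hC fun x => h x.ofLp

theorem norm_le_of_bilin [DecidableEq κ] (A : Matrix ι κ ℂ) {C : ℝ} (hC : 0 ≤ C)
    (h : ∀ (w : ι → ℂ) (v : κ → ℂ), ‖∑ i, ∑ j, w i * A i j * v j‖ ≤ C * nv w * nv v) :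
    ‖A‖ ≤ C := by
  refine norm_le_of_mulVec A hC fun v => ?_
  have h1 := h (star (A.mulVec v)) v
  have h2 : ∑ i, ∑ j, (star (A.mulVec v)) i * A i j * v j = ((nv (A.mulVec v) ^ 2 : ℝ) : ℂ) := by
    rw [nv_sq]
    push_cast
    refine Finset.sum_congr rfl fun i _ => ?_
    rw [← Complex.conj_mul']
    simp [Matrix.mulVec, dotProduct, Finset.mul_sum, mul_assoc]
  have h3 : nv (star (A.mulVec v)) = nv (A.mulVec v) := by
    have : nv (star (A.mulVec v)) ^ 2 = nv (A.mulVec v) ^ 2 := by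
      rw [nv_sq, nv_sq]; simp
    exact (sq_eq_sq₀ (nv_nonneg _) (nv_nonneg _)).1 this
  rw [h2, h3, Complex.norm_real, Real.norm_eq_abs, abs_of_nonneg (sq_nonneg _)] at h1
  rcases (nv_nonneg (A.mulVec v)).eq_or_lt with h0 | h0
  · rw [← h0]; exact mul_nonneg hC (nv_nonneg _)
  · nlinarith

theorem norm_dot_le (w v : ι → ℂ) : ‖∑ i, w i * v i‖ ≤ nv w * nv v := by
  have h := norm_inner_le_norm (𝕜 := ℂ) (WithLp.toLp 2 (star w)) (WithLp.toLp 2 v)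
  have h3 : nv (star w) = nv w := by
    have : nv (star w) ^ 2 = nv w ^ 2 := by
      rw [nv_sq, nv_sq]; simp
    exact (sq_eq_sq₀ (nv_nonneg _) (nv_nonneg _)).1 this
  rw [← h3]
  refine le_trans (le_of_eq ?_) h
  congr 1
  simp [PiLp.inner_apply, mul_comm]

theorem norm_row_le [DecidableEq ι] (w : ι → ℂ) :
    ‖(Matrix.of fun _ k => w k : Matrix (Fin 1) ι ℂ)‖ ≤ nv w := by
  refine norm_le_of_mulVec _ (nv_nonneg w) fun v => ?_
  refine nv_le_of_sq (mul_nonneg (nv_nonneg _) (nv_nonneg _)) ?_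
  simp only [Finset.univ_unique, Finset.sum_singleton]
  exact pow_le_pow_left₀ (norm_nonneg _) (norm_dot_le w v) 2

theorem norm_col_le (w : ι → ℂ) : ‖(Matrix.of fun k _ => w k : Matrix ι (Fin 1) ℂ)‖ ≤ nv w := by
  refine norm_le_of_mulVec _ (nv_nonneg w) fun v => ?_
  refine nv_le_of_sq (mul_nonneg (nv_nonneg _) (nv_nonneg _)) (le_of_eq ?_)
  rw [mul_pow, nv_sq, nv_sq, Finset.sum_mul]
  simp [Matrix.mulVec, dotProduct, mul_pow]

theorem nv_slice_le (w : ι × κ → ℂ) (i : ι) : nv (fun k => w (i, k)) ≤ nv w := by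
  refine nv_le_of_sq (nv_nonneg _) ?_
  rw [nv_sq, Fintype.sum_prod_type]
  exact Finset.single_le_sum (f := fun i => ∑ k, ‖w (i, k)‖ ^ 2)
    (fun i _ => Finset.sum_nonneg fun _ _ => sq_nonneg _) (Finset.mem_univ i)

/-- The matrix `a ⊗ 1`. -/
def amp [DecidableEq κ] {ι' : Type*} (a : Matrix ι ι' ℂ) : Matrix (ι × κ) (ι' × κ) ℂ :=
  Matrix.of fun p q => if p.2 = q.2 then a p.1 q.1 else 0

theorem norm_amp_le [DecidableEq κ] {ι' : Type*} [Fintype ι'] [DecidableEq ι']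
    (a : Matrix ι ι' ℂ) : ‖(amp a : Matrix (ι × κ) (ι' × κ) ℂ)‖ ≤ ‖a‖ := by
  refine norm_le_of_mulVec _ (norm_nonneg a) fun v => ?_
  refine nv_le_of_sq (mul_nonneg (norm_nonneg _) (nv_nonneg _)) ?_
  rw [mul_pow, nv_sq, Fintype.sum_prod_type_right, Fintype.sum_prod_type_right, Finset.mul_sum]
  refine Finset.sum_le_sum fun k _ => ?_
  have h := pow_le_pow_left₀ (nv_nonneg _) (nv_mulVec_le a (fun j => v (j, k))) 2
  rw [mul_pow, nv_sq, nv_sq] at h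
  refine le_trans (le_of_eq ?_) h
  refine Finset.sum_congr rfl fun i _ => ?_
  congr 2
  simp [Matrix.mulVec, dotProduct, amp, Fintype.sum_prod_type, ite_mul]

end Scalar

section Basic

variable {E : Type u} [NormedAddCommGroup E] [NormedSpace ℂ E] [OperatorSpace E]

theorem matNorm_zero (n : ℕ) : matNorm n (0 : Matrix (Fin n) (Fin n) E) = 0 := by
  simpa using matNorm_smul n (0 : ℂ) (0 : Matrix (Fin n) (Fin n) E)

theorem matNorm_nonneg (n : ℕ) (x : Matrix (Fin n) (Fin n) E) : 0 ≤ matNorm n x := by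
  have h1 := matNorm_add_le n x ((-1 : ℂ) • x)
  have h2 := matNorm_smul n (-1 : ℂ) x
  simp [matNorm_zero] at h1 h2
  linarith

theorem norm_functional_le (f : StrongDual ℂ E) {m : ℕ} (x : Matrix (Fin m) (Fin m) E)
    (w v : Fin m → ℂ) :
    ‖∑ k, ∑ l, w k * f (x k l) * v l‖ ≤ ‖f‖ * matNorm m x * nv w * nv v := by
  let a : Matrix (Fin 1) (Fin m) ℂ := Matrix.of fun _ k => w k
  let b : Matrix (Fin m) (Fin 1) ℂ := Matrix.of fun l _ => v l
  let z : E := ∑ k, ∑ l, (w k * v l) • x k l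
  have h1 : matNorm 1 (sandwich a x b) = ‖z‖ := matNorm_one z
  have h2 := matNorm_sandwich_le 1 m a x b
  have h3 : ∑ k, ∑ l, w k * f (x k l) * v l = f z := by
    simp only [z, map_sum, map_smul, smul_eq_mul]
    exact Finset.sum_congr rfl fun k _ => Finset.sum_congr rfl fun l _ => by ring
  have h4 : ‖a‖ * matNorm m x * ‖b‖ ≤ nv w * matNorm m x * nv v := by
    have := matNorm_nonneg m x
    have := nv_nonneg w
    gcongr
    · exact norm_row_le w
    · exact norm_col_le v
  rw [h3]
  calc ‖f z‖ ≤ ‖f‖ * ‖z‖ := f.le_opNorm z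
    _ ≤ ‖f‖ * (nv w * matNorm m x * nv v) := by
        gcongr
        linarith
    _ = _ := by ring

theorem norm_map_functional_le (f : StrongDual ℂ E) {m : ℕ} (x : Matrix (Fin m) (Fin m) E) :
    ‖(x.map f : Matrix (Fin m) (Fin m) ℂ)‖ ≤ ‖f‖ * matNorm m x :=
  norm_le_of_bilin _ (mul_nonneg (norm_nonneg _) (matNorm_nonneg m x))
    fun w v => norm_functional_le f x w v

/-! ### The dual operator space -/

/-- The scalar matrix `[f_ij(x_kl)]` of size `nm`. -/
def pairing {n m : ℕ} (f : Matrix (Fin n) (Fin n) (StrongDual ℂ E))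
    (x : Matrix (Fin m) (Fin m) E) : Matrix (Fin n × Fin m) (Fin n × Fin m) ℂ :=
  Matrix.of fun p q => f p.1 q.1 (x p.2 q.2)

/-- The norm of `[f_ij] ∈ M_n(E*)`: the c.b. norm of the map `x ↦ [f_ij(x)]` from `E` to `M_n`. -/
def dualMatNorm (n : ℕ) (f : Matrix (Fin n) (Fin n) (StrongDual ℂ E)) : ℝ :=
  sInf {C : ℝ | 0 ≤ C ∧ ∀ (m : ℕ) (x : Matrix (Fin m) (Fin m) E),
    ‖pairing f x‖ ≤ C * matNorm m x}

theorem pairing_bound {n : ℕ} (f : Matrix (Fin n) (Fin n) (StrongDual ℂ E)) (m : ℕ)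
    (x : Matrix (Fin m) (Fin m) E) : ‖pairing f x‖ ≤ (∑ i, ∑ j, ‖f i j‖) * matNorm m x := by
  have hx := matNorm_nonneg m x
  have hs : 0 ≤ ∑ i, ∑ j, ‖f i j‖ :=
    Finset.sum_nonneg fun i _ => Finset.sum_nonneg fun j _ => norm_nonneg _
  refine norm_le_of_bilin _ (mul_nonneg hs hx) fun w v => ?_
  have h1 : ∑ p, ∑ q, w p * pairing f x p q * v q =
      ∑ i, ∑ j, ∑ k, ∑ l, w (i, k) * f i j (x k l) * v (j, l) := by
    simp only [Fintype.sum_prod_type, pairing]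
    exact Finset.sum_congr rfl fun i _ => Finset.sum_comm
  rw [h1, Finset.sum_mul, Finset.sum_mul, Finset.sum_mul]
  refine (norm_sum_le _ _).trans (Finset.sum_le_sum fun i _ => ?_)
  rw [Finset.sum_mul, Finset.sum_mul, Finset.sum_mul]
  refine (norm_sum_le _ _).trans (Finset.sum_le_sum fun j _ => ?_)
  refine (norm_functional_le (f i j) x (fun k => w (i, k)) (fun l => v (j, l))).trans ?_
  have := nv_nonneg w
  have := nv_nonneg (fun l => v (j, l))
  gcongr
  · exact nv_slice_le w i
  · exact nv_slice_le v j

theorem dualMatNorm_le {n : ℕ} (f : Matrix (Fin n) (Fin n) (StrongDual ℂ E)) {C : ℝ} (hC : 0 ≤ C)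
    (h : ∀ (m : ℕ) (x : Matrix (Fin m) (Fin m) E), ‖pairing f x‖ ≤ C * matNorm m x) :
    dualMatNorm n f ≤ C :=
  csInf_le ⟨0, fun _ hc => hc.1⟩ ⟨hC, h⟩

theorem dualMatNorm_nonneg {n : ℕ} (f : Matrix (Fin n) (Fin n) (StrongDual ℂ E)) :
    0 ≤ dualMatNorm n f :=
  Real.sInf_nonneg fun _ hc => hc.1

theorem pairing_le {n m : ℕ} (f : Matrix (Fin n) (Fin n) (StrongDual ℂ E))
    (x : Matrix (Fin m) (Fin m) E) : ‖pairing f x‖ ≤ dualMatNorm n f * matNorm m x := by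
  rcases (matNorm_nonneg m x).eq_or_lt with h0 | h0
  · have := pairing_bound f m x
    rw [← h0] at this ⊢
    simpa using this
  · rw [← div_le_iff₀ h0]
    refine le_csInf ⟨_, ?_, pairing_bound f⟩ fun C hC => ?_
    · exact Finset.sum_nonneg fun i _ => Finset.sum_nonneg fun j _ => norm_nonneg _
    · rw [div_le_iff₀ h0]
      exact hC.2 m x

theorem pairing_sandwich {n m p : ℕ} (a : Matrix (Fin p) (Fin n) ℂ)
    (f : Matrix (Fin n) (Fin n) (StrongDual ℂ E)) (b : Matrix (Fin n) (Fin p) ℂ)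
    (x : Matrix (Fin m) (Fin m) E) :
    pairing (sandwich a f b) x = (amp a : Matrix (Fin p × Fin m) (Fin n × Fin m) ℂ) * pairing f x * (amp b : Matrix (Fin n × Fin m) (Fin p × Fin m) ℂ) := by
  ext ⟨i, k⟩ ⟨j, l⟩
  simp only [pairing, sandwich, Matrix.mul_apply, Matrix.of_apply, amp, Fintype.sum_prod_type, ite_mul, mul_ite,
    zero_mul, mul_zero, Finset.sum_ite_eq, Finset.sum_ite_eq', Finset.mem_univ, if_true,
    Finset.sum_mul, sum_apply, FunLike.coe_smul, Pi.smul_apply, smul_eq_mul]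
  rw [Finset.sum_comm]
  exact Finset.sum_congr rfl fun r _ => Finset.sum_congr rfl fun s _ => by ring

theorem nv_sq_add {n p m : ℕ} (v : Fin (n + p) × Fin m → ℂ) :
    nv v ^ 2 = nv (fun q : Fin n × Fin m => v (Fin.castAdd p q.1, q.2)) ^ 2 +
      nv (fun q : Fin p × Fin m => v (Fin.natAdd n q.1, q.2)) ^ 2 := by
  simp only [nv_sq, Fintype.sum_prod_type, Fin.sum_univ_add]

theorem pairing_directSum_castAdd {n p m : ℕ} (f : Matrix (Fin n) (Fin n) (StrongDual ℂ E))
    (g : Matrix (Fin p) (Fin p) (StrongDual ℂ E)) (x : Matrix (Fin m) (Fin m) E)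
    (v : Fin (n + p) × Fin m → ℂ) (q : Fin n × Fin m) :
    (pairing (directSum f g) x).mulVec v (Fin.castAdd p q.1, q.2) =
      (pairing f x).mulVec (fun q => v (Fin.castAdd p q.1, q.2)) q := by
  simp [Matrix.mulVec, dotProduct, Fintype.sum_prod_type, Fin.sum_univ_add, pairing, directSum]

theorem pairing_directSum_natAdd {n p m : ℕ} (f : Matrix (Fin n) (Fin n) (StrongDual ℂ E))
    (g : Matrix (Fin p) (Fin p) (StrongDual ℂ E)) (x : Matrix (Fin m) (Fin m) E)
    (v : Fin (n + p) × Fin m → ℂ) (q : Fin p × Fin m) :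
    (pairing (directSum f g) x).mulVec v (Fin.natAdd n q.1, q.2) =
      (pairing g x).mulVec (fun q => v (Fin.natAdd n q.1, q.2)) q := by
  simp [Matrix.mulVec, dotProduct, Fintype.sum_prod_type, Fin.sum_univ_add, pairing, directSum]

theorem nv_zero' {ι : Type*} [Fintype ι] : nv (fun _ : ι => (0 : ℂ)) = 0 := by
  have : nv (fun _ : ι => (0 : ℂ)) ^ 2 = 0 := by rw [nv_sq]; simp
  exact pow_eq_zero_iff two_ne_zero |>.1 this

theorem norm_pairing_directSum {n p m : ℕ} (f : Matrix (Fin n) (Fin n) (StrongDual ℂ E))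
    (g : Matrix (Fin p) (Fin p) (StrongDual ℂ E)) (x : Matrix (Fin m) (Fin m) E) :
    ‖pairing (directSum f g) x‖ = max ‖pairing f x‖ ‖pairing g x‖ := by
  apply le_antisymm
  · have hM : 0 ≤ max ‖pairing f x‖ ‖pairing g x‖ := le_max_of_le_left (norm_nonneg _)
    refine norm_le_of_mulVec _ hM fun v => ?_
    refine (sq_le_sq₀ (nv_nonneg _) (mul_nonneg hM (nv_nonneg _))).1 ?_
    rw [mul_pow, nv_sq_add, nv_sq_add v, mul_add, ← mul_pow, ← mul_pow]
    simp only [pairing_directSum_castAdd, pairing_directSum_natAdd]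
    refine add_le_add (pow_le_pow_left₀ (nv_nonneg _) ?_ 2) (pow_le_pow_left₀ (nv_nonneg _) ?_ 2)
    · exact (nv_mulVec_le _ _).trans (mul_le_mul_of_nonneg_right (le_max_left _ _) (nv_nonneg _))
    · exact (nv_mulVec_le _ _).trans (mul_le_mul_of_nonneg_right (le_max_right _ _) (nv_nonneg _))
  · refine max_le ?_ ?_
    · refine norm_le_of_mulVec _ (norm_nonneg _) fun v => ?_
      let v' : Fin (n + p) × Fin m → ℂ := fun q => Fin.addCases (fun i => v (i, q.2)) (fun _ => 0) q.1
      have e1 : (fun q : Fin n × Fin m => v' (Fin.castAdd p q.1, q.2)) = v := by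
        funext q; simp [v']
      have e2 : (fun q : Fin p × Fin m => v' (Fin.natAdd n q.1, q.2)) = fun _ => 0 := by
        funext q; simp [v']
      have h1 := nv_sq_add v'
      rw [e1, e2, nv_zero'] at h1
      have h2 : nv v' = nv v :=
        (sq_eq_sq₀ (nv_nonneg _) (nv_nonneg _)).1 (by linarith)
      have h3 := nv_sq_add ((pairing (directSum f g) x).mulVec v')
      simp only [pairing_directSum_castAdd, e1] at h3
      rw [← h2]
      refine le_trans ?_ (nv_mulVec_le _ v')
      refine (sq_le_sq₀ (nv_nonneg _) (nv_nonneg _)).1 ?_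
      rw [h3]
      exact le_add_of_nonneg_right (sq_nonneg _)
    · refine norm_le_of_mulVec _ (norm_nonneg _) fun v => ?_
      let v' : Fin (n + p) × Fin m → ℂ := fun q => Fin.addCases (fun _ => 0) (fun i => v (i, q.2)) q.1
      have e1 : (fun q : Fin n × Fin m => v' (Fin.castAdd p q.1, q.2)) = fun _ => 0 := by
        funext q; simp [v']
      have e2 : (fun q : Fin p × Fin m => v' (Fin.natAdd n q.1, q.2)) = v := by
        funext q; simp [v']
      have h1 := nv_sq_add v'
      rw [e1, e2, nv_zero'] at h1
      have h2 : nv v' = nv v :=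
        (sq_eq_sq₀ (nv_nonneg _) (nv_nonneg _)).1 (by linarith)
      have h3 := nv_sq_add ((pairing (directSum f g) x).mulVec v')
      simp only [pairing_directSum_natAdd, e2] at h3
      rw [← h2]
      refine le_trans ?_ (nv_mulVec_le _ v')
      refine (sq_le_sq₀ (nv_nonneg _) (nv_nonneg _)).1 ?_
      rw [h3]
      exact le_add_of_nonneg_left (sq_nonneg _)

theorem dualMatNorm_smul_le {n : ℕ} (c : ℂ) (f : Matrix (Fin n) (Fin n) (StrongDual ℂ E)) :
    dualMatNorm n (c • f) ≤ ‖c‖ * dualMatNorm n f := by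
  refine dualMatNorm_le _ (mul_nonneg (norm_nonneg _) (dualMatNorm_nonneg _)) fun m x => ?_
  have : pairing (c • f) x = c • pairing f x := by
    ext p q; simp [pairing]
  rw [this, norm_smul, mul_assoc]
  gcongr
  exact pairing_le f x

theorem norm_entry_le {ι κ : Type*} [Fintype ι] [Fintype κ] [DecidableEq κ]
    (A : Matrix ι κ ℂ) (i : ι) (j : κ) : ‖A i j‖ ≤ ‖A‖ := by
  have h := nv_mulVec_le A (Pi.single j 1)
  have h1 : nv (Pi.single j (1 : ℂ)) = 1 := by simp [nv]
  rw [h1, mul_one] at h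
  refine le_trans ?_ h
  have h2 : ‖A.mulVec (Pi.single j 1) i‖ ^ 2 ≤ nv (A.mulVec (Pi.single j 1)) ^ 2 := by
    rw [nv_sq]
    exact Finset.single_le_sum (f := fun i => ‖A.mulVec (Pi.single j 1) i‖ ^ 2)
      (fun _ _ => sq_nonneg _) (Finset.mem_univ i)
  have h3 := (sq_le_sq₀ (norm_nonneg _) (nv_nonneg _)).1 h2
  simpa using h3

theorem norm_apply_entry_le {n : ℕ} (f : Matrix (Fin n) (Fin n) (StrongDual ℂ E)) (i j : Fin n)
    (x : E) : ‖f i j x‖ ≤ dualMatNorm n f * ‖x‖ := by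
  have h := pairing_le f (Matrix.of fun _ _ => x : Matrix (Fin 1) (Fin 1) E)
  rw [matNorm_one] at h
  exact (norm_entry_le (pairing f (Matrix.of fun _ _ => x : Matrix (Fin 1) (Fin 1) E)) (i, 0) (j, 0)).trans h

/-- The standard operator space structure on the dual of an operator space, given by
`M_n(E*) = CB(E, M_n)`. -/
instance instDual : OperatorSpace (StrongDual ℂ E) where
  matNorm := dualMatNorm
  matNorm_one f := by
    apply le_antisymm
    · refine dualMatNorm_le _ (norm_nonneg _) fun m x => ?_
      simpa using pairing_bound (Matrix.of fun _ _ => f : Matrix (Fin 1) (Fin 1) (StrongDual ℂ E)) m x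
    · exact ContinuousLinearMap.opNorm_le_bound _ (dualMatNorm_nonneg _) fun x =>
        norm_apply_entry_le (Matrix.of fun _ _ => f : Matrix (Fin 1) (Fin 1) (StrongDual ℂ E)) 0 0 x
  matNorm_add_le n f g := by
    refine dualMatNorm_le _ (add_nonneg (dualMatNorm_nonneg _) (dualMatNorm_nonneg _))
      fun m x => ?_
    have : pairing (f + g) x = pairing f x + pairing g x := by
      ext p q; simp [pairing]
    rw [this, add_mul]
    exact (norm_add_le _ _).trans (add_le_add (pairing_le f x) (pairing_le g x))
  matNorm_smul n c f := by
    apply le_antisymm (dualMatNorm_smul_le c f)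
    rcases eq_or_ne c 0 with rfl | hc
    · rw [norm_zero, zero_mul]
      exact dualMatNorm_nonneg _
    · have h := dualMatNorm_smul_le c⁻¹ (c • f)
      rw [smul_smul, inv_mul_cancel₀ hc, one_smul, norm_inv] at h
      rwa [← le_inv_mul_iff₀ (norm_pos_iff.2 hc)]
  eq_zero_of_matNorm n f hf := by
    ext i j x
    have h := norm_apply_entry_le f i j x
    rw [hf, zero_mul] at h
    simpa using h
  matNorm_sandwich_le p n a f b := by
    refine dualMatNorm_le _ (mul_nonneg (mul_nonneg (norm_nonneg _) (dualMatNorm_nonneg _))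
      (norm_nonneg _)) fun m x => ?_
    rw [pairing_sandwich]
    have hp := pairing_le f x
    have h0 := mul_nonneg (dualMatNorm_nonneg f) (matNorm_nonneg m x)
    calc ‖(amp a : Matrix (Fin p × Fin m) (Fin n × Fin m) ℂ) * pairing f x *
          (amp b : Matrix (Fin n × Fin m) (Fin p × Fin m) ℂ)‖
        ≤ ‖(amp a : Matrix (Fin p × Fin m) (Fin n × Fin m) ℂ)‖ * ‖pairing f x‖ *
          ‖(amp b : Matrix (Fin n × Fin m) (Fin p × Fin m) ℂ)‖ :=
        (Matrix.l2_opNorm_mul _ _).trans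
          (mul_le_mul_of_nonneg_right (Matrix.l2_opNorm_mul _ _) (norm_nonneg _))
      _ ≤ ‖a‖ * (dualMatNorm n f * matNorm m x) * ‖b‖ := by
        gcongr
        · exact norm_amp_le a
        · exact norm_amp_le b
      _ = _ := by ring
  matNorm_directSum n p f g := by
    apply le_antisymm
    · refine dualMatNorm_le _ (le_max_of_le_left (dualMatNorm_nonneg f)) fun m x => ?_
      rw [norm_pairing_directSum, max_mul_of_nonneg _ _ (matNorm_nonneg m x)]
      exact max_le_max (pairing_le f x) (pairing_le g x)
    · refine max_le (dualMatNorm_le _ (dualMatNorm_nonneg _) fun m x => ?_)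
        (dualMatNorm_le _ (dualMatNorm_nonneg _) fun m x => ?_)
      · refine le_trans ?_ (pairing_le (directSum f g) x)
        rw [norm_pairing_directSum]
        exact le_max_left _ _
      · refine le_trans ?_ (pairing_le (directSum f g) x)
        rw [norm_pairing_directSum]
        exact le_max_right _ _

end Basic

/-! ### Completely bounded maps -/

section CB

variable {E F G : Type u} [NormedAddCommGroup E] [NormedSpace ℂ E] [OperatorSpace E]
  [NormedAddCommGroup F] [NormedSpace ℂ F] [OperatorSpace F]
  [NormedAddCommGroup G] [NormedSpace ℂ G] [OperatorSpace G]

/-- `‖[T x_ij]‖ ≤ C ‖[x_ij]‖` for all matrices `[x_ij]` of all sizes. -/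
def CBBound (T : E →L[ℂ] F) (C : ℝ) : Prop :=
  ∀ (n : ℕ) (x : Matrix (Fin n) (Fin n) E), matNorm n (x.map T) ≤ C * matNorm n x

variable (E F) in
/-- The space `CB(E, F)` of completely bounded linear maps, with the c.b. norm. -/
structure CB where
  toCLM : E →L[ℂ] F
  exists_bound : ∃ C : ℝ, 0 ≤ C ∧ CBBound toCLM C

namespace CB

theorem toCLM_injective : Function.Injective (toCLM : CB E F → E →L[ℂ] F) := by
  rintro ⟨S, hS⟩ ⟨T, hT⟩ h
  cases h
  rfl

theorem CBBound_add {S T : E →L[ℂ] F} {C D : ℝ} (hS : CBBound S C) (hT : CBBound T D) :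
    CBBound (S + T) (C + D) := fun n x => by
  have : x.map (S + T) = x.map S + x.map T := by ext i j; simp
  rw [this, add_mul]
  exact (matNorm_add_le n _ _).trans (add_le_add (hS n x) (hT n x))

theorem CBBound_smul {T : E →L[ℂ] F} {C : ℝ} (c : ℂ) (hT : CBBound T C) :
    CBBound (c • T) (‖c‖ * C) := fun n x => by
  have : x.map (c • T) = c • x.map T := by ext i j; simp
  rw [this, matNorm_smul, mul_assoc]
  exact mul_le_mul_of_nonneg_left (hT n x) (norm_nonneg c)

theorem CBBound_zero : CBBound (0 : E →L[ℂ] F) 0 := fun n x => by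
  have : x.map (0 : E →L[ℂ] F) = 0 := by ext i j; simp
  rw [this, matNorm_zero, zero_mul]

variable (E F) in
/-- The completely bounded maps as a linear subspace of the bounded maps. -/
def submodule : Submodule ℂ (E →L[ℂ] F) where
  carrier := {T | ∃ C : ℝ, 0 ≤ C ∧ CBBound T C}
  add_mem' := by
    rintro S T ⟨C, hC, hS⟩ ⟨D, hD, hT⟩
    exact ⟨C + D, add_nonneg hC hD, CBBound_add hS hT⟩
  zero_mem' := ⟨0, le_rfl, CBBound_zero⟩
  smul_mem' := by
    rintro c T ⟨C, hC, hT⟩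
    exact ⟨‖c‖ * C, mul_nonneg (norm_nonneg c) hC, CBBound_smul c hT⟩

variable (E F) in
/-- `CB(E, F)` is the subspace of completely bounded maps. -/
def equivSubmodule : CB E F ≃ submodule E F where
  toFun T := ⟨T.toCLM, T.exists_bound⟩
  invFun T := ⟨T.1, T.2⟩

instance : AddCommGroup (CB E F) := (equivSubmodule E F).addCommGroup

instance : Module ℂ (CB E F) := (equivSubmodule E F).module ℂ

@[simp] theorem toCLM_add (S T : CB E F) : (S + T).toCLM = S.toCLM + T.toCLM := rfl

@[simp] theorem toCLM_smul (c : ℂ) (T : CB E F) : (c • T).toCLM = c • T.toCLM := rfl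

@[simp] theorem toCLM_zero : (0 : CB E F).toCLM = 0 := rfl

/-- The completely bounded norm. -/
instance : Norm (CB E F) where
  norm T := sInf {C : ℝ | 0 ≤ C ∧ CBBound T.toCLM C}

theorem norm_def (T : CB E F) : ‖T‖ = sInf {C : ℝ | 0 ≤ C ∧ CBBound T.toCLM C} := rfl

theorem cbNorm_nonneg (T : CB E F) : 0 ≤ ‖T‖ := Real.sInf_nonneg fun _ hc => hc.1

theorem cbNorm_le {T : CB E F} {C : ℝ} (hC : 0 ≤ C) (h : CBBound T.toCLM C) : ‖T‖ ≤ C :=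
  csInf_le ⟨0, fun _ hc => hc.1⟩ ⟨hC, h⟩

theorem bound (T : CB E F) : CBBound T.toCLM ‖T‖ := fun n x => by
  rcases (matNorm_nonneg n x).eq_or_lt with h0 | h0
  · obtain ⟨C, hC, h⟩ := T.exists_bound
    have := h n x
    rw [← h0] at this ⊢
    simpa using this
  · rw [← div_le_iff₀ h0]
    refine le_csInf T.exists_bound fun C hC => ?_
    rw [div_le_iff₀ h0]
    exact hC.2 n x

theorem le_norm (T : CB E F) (x : E) : ‖T.toCLM x‖ ≤ ‖T‖ * ‖x‖ := by
  have h := T.bound 1 (Matrix.of fun _ _ => x)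
  rw [matNorm_one] at h
  have h1 : (Matrix.of fun _ _ => x : Matrix (Fin 1) (Fin 1) E).map T.toCLM =
      Matrix.of fun _ _ => T.toCLM x := rfl
  rwa [h1, matNorm_one] at h

theorem cbNorm_smul_le (c : ℂ) (T : CB E F) : ‖c • T‖ ≤ ‖c‖ * ‖T‖ :=
  cbNorm_le (mul_nonneg (norm_nonneg c) T.cbNorm_nonneg) (CBBound_smul c T.bound)

theorem core : NormedSpace.Core ℂ (CB E F) where
  norm_nonneg := cbNorm_nonneg
  norm_smul c T := by
    apply le_antisymm (cbNorm_smul_le c T)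
    rcases eq_or_ne c 0 with rfl | hc
    · simpa using cbNorm_nonneg (0 : CB E F)
    · have h := cbNorm_smul_le c⁻¹ (c • T)
      rw [smul_smul, inv_mul_cancel₀ hc, one_smul, norm_inv] at h
      rwa [← le_inv_mul_iff₀ (norm_pos_iff.2 hc)]
  norm_triangle S T :=
    cbNorm_le (add_nonneg S.cbNorm_nonneg T.cbNorm_nonneg) (CBBound_add S.bound T.bound)
  norm_eq_zero_iff T := by
    constructor
    · intro h
      apply toCLM_injective
      ext x
      have := T.le_norm x
      rw [h, zero_mul] at this
      simpa using this
    · rintro rfl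
      exact le_antisymm (cbNorm_le le_rfl CBBound_zero) (cbNorm_nonneg _)

instance : NormedAddCommGroup (CB E F) := NormedAddCommGroup.ofCore core

instance : NormedSpace ℂ (CB E F) := NormedSpace.ofCore core

/-- Composition of completely bounded maps. -/
def comp (S : CB F G) (T : CB E F) : CB E G where
  toCLM := S.toCLM.comp T.toCLM
  exists_bound := ⟨‖S‖ * ‖T‖, mul_nonneg S.cbNorm_nonneg T.cbNorm_nonneg, fun n x => by
    have h : x.map (S.toCLM.comp T.toCLM) = (x.map T.toCLM).map S.toCLM := by
      ext i j; simp
    rw [h, mul_assoc]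
    exact (S.bound n _).trans (mul_le_mul_of_nonneg_left (T.bound n x) S.cbNorm_nonneg)⟩

/-- The adjoint `T* : F* → E*`, `T* f = f ∘ T`. -/
def adjoint (T : CB E F) : CB (StrongDual ℂ F) (StrongDual ℂ E) where
  toCLM := ContinuousLinearMap.precomp ℂ T.toCLM
  exists_bound := ⟨‖T‖, T.cbNorm_nonneg, fun n f => by
    refine dualMatNorm_le _ (mul_nonneg T.cbNorm_nonneg (matNorm_nonneg n f)) fun m x => ?_
    have h : pairing (f.map (ContinuousLinearMap.precomp ℂ T.toCLM)) x =
        pairing f (x.map T.toCLM) := by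
      ext p q; simp [pairing]
    rw [h]
    calc ‖pairing f (x.map T.toCLM)‖ ≤ matNorm n f * matNorm m (x.map T.toCLM) := pairing_le f _
      _ ≤ matNorm n f * (‖T‖ * matNorm m x) :=
        mul_le_mul_of_nonneg_left (T.bound m x) (matNorm_nonneg n f)
      _ = _ := by ring⟩

/-- `T` is a complete isometry (a completely isometric inclusion). -/
def IsCompleteIsometry (T : CB E F) : Prop :=
  ∀ (n : ℕ) (x : Matrix (Fin n) (Fin n) E), matNorm n (x.map T.toCLM) = matNorm n x

/-- `T` has finite rank. -/
def IsFiniteRank (T : CB E F) : Prop :=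
  FiniteDimensional ℂ (LinearMap.range (T.toCLM : E →ₗ[ℂ] F))

end CB

/-! ### Local reflexivity -/

theorem matNorm_diag (x : E) (n : ℕ) :
    matNorm n (Matrix.of fun i j => if i = j then x else 0 : Matrix (Fin n) (Fin n) E) ≤ ‖x‖ := by
  induction n with
  | zero =>
    have : (Matrix.of fun i j => if i = j then x else 0 : Matrix (Fin 0) (Fin 0) E) = 0 := by
      ext i; exact i.elim0
    rw [this, matNorm_zero]
    exact norm_nonneg x
  | succ n ih =>
    have : (Matrix.of fun i j => if i = j then x else 0 : Matrix (Fin (n + 1)) (Fin (n + 1)) E) =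
        directSum (Matrix.of fun i j => if i = j then x else 0 : Matrix (Fin n) (Fin n) E)
          (Matrix.of fun _ _ => x : Matrix (Fin 1) (Fin 1) E) := by
      ext i j
      refine Fin.addCases (fun i => ?_) (fun i => ?_) i <;>
      refine Fin.addCases (fun j => ?_) (fun j => ?_) j
      · simp [directSum, Matrix.fromBlocks]
      · have : Fin.castAdd 1 i ≠ Fin.natAdd n j := by
          intro h; have := congrArg Fin.val h; simp at this; omega
        simp [directSum, Matrix.fromBlocks, this]
      · have : Fin.natAdd n i ≠ Fin.castAdd 1 j := by
          intro h; have := congrArg Fin.val h; simp at this; omega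
        simp [directSum, Matrix.fromBlocks, this]
      · have : i = j := Subsingleton.elim _ _
        subst this
        simp [directSum, Matrix.fromBlocks]
    rw [this, matNorm_directSum, matNorm_one]
    exact max_le ih le_rfl

/-- A rank one map `y ↦ f(y) x` satisfies `‖f ⊗ x‖_cb ≤ ‖f‖ ‖x‖`. -/
theorem CBBound_smulRight (f : StrongDual ℂ E) (x : F) :
    CBBound (f.smulRight x) (‖f‖ * ‖x‖) := fun n y => by
  have h : y.map (f.smulRight x) =
      sandwich (y.map f) (Matrix.of fun i j => if i = j then x else 0 : Matrix (Fin n) (Fin n) F) 1 := by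
    ext i j
    simp [sandwich, Matrix.one_apply]
  rw [h]
  have h1 : ‖(1 : Matrix (Fin n) (Fin n) ℂ)‖ ≤ 1 :=
    norm_le_of_mulVec _ zero_le_one fun v => by simp
  have h2 := norm_map_functional_le f y
  have h3 := matNorm_diag x n
  have h4 := matNorm_nonneg n (Matrix.of fun i j => if i = j then x else 0 : Matrix (Fin n) (Fin n) F)
  have h5 := matNorm_nonneg n y
  calc _ ≤ ‖(y.map f : Matrix (Fin n) (Fin n) ℂ)‖ *
        matNorm n (Matrix.of fun i j => if i = j then x else 0 : Matrix (Fin n) (Fin n) F) *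
        ‖(1 : Matrix (Fin n) (Fin n) ℂ)‖ := matNorm_sandwich_le _ _ _ _ _
    _ ≤ (‖f‖ * matNorm n y) * ‖x‖ * 1 := by gcongr
    _ = _ := by ring

variable (F) in
/-- The map `F → CB(E, F)`, `x ↦ f ⊗ x`, where `(f ⊗ x)(y) = f(y) x`. -/
def CB.tmul (f : StrongDual ℂ E) : F →L[ℂ] CB E F :=
  LinearMap.mkContinuous
    { toFun := fun x => ⟨f.smulRight x, _, by positivity, CBBound_smulRight f x⟩
      map_add' := fun x y => CB.toCLM_injective (by ext; simp)
      map_smul' := fun c x => CB.toCLM_injective (by ext y; exact smul_comm (f y) c x) }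
    ‖f‖ fun x => CB.cbNorm_le (by positivity) (CBBound_smulRight f x)

/-- The natural map `CB(L, E**) → CB(L, E)**` for finite-dimensional `L`. It is the linear map
sending `f ⊗ z` (with `f ∈ L*`, `z ∈ E**`) to the functional `φ ↦ z(x ↦ φ(f ⊗ x))`, see
`natMap_tmul`; a general `u` is written as `∑ᵢ bᵢ* ⊗ u(bᵢ)` for a basis `b` of `L`. -/
def natMap {L : Type u} [NormedAddCommGroup L] [NormedSpace ℂ L] [OperatorSpace L]
    [FiniteDimensional ℂ L] (u : CB L (StrongDual ℂ (StrongDual ℂ E))) :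
    StrongDual ℂ (StrongDual ℂ (CB L E)) :=
  ∑ i, (u.toCLM (Module.finBasis ℂ L i)).comp
    (ContinuousLinearMap.precomp ℂ
      (CB.tmul E (LinearMap.toContinuousLinearMap ((Module.finBasis ℂ L).coord i))))

theorem natMap_tmul {L : Type u} [NormedAddCommGroup L] [NormedSpace ℂ L] [OperatorSpace L]
    [FiniteDimensional ℂ L] (f : StrongDual ℂ L) (z : StrongDual ℂ (StrongDual ℂ E))
    (φ : StrongDual ℂ (CB L E)) :
    natMap (CB.tmul _ f z) φ = z (φ.comp (CB.tmul E f)) := by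
  have key : CB.tmul E f = ∑ i, f (Module.finBasis ℂ L i) •
      CB.tmul E (LinearMap.toContinuousLinearMap ((Module.finBasis ℂ L).coord i)) := by
    ext x
    apply CB.toCLM_injective
    ext y
    have hs : ∀ (s : Finset (Fin (Module.finrank ℂ L))) (g : Fin (Module.finrank ℂ L) → CB L E),
        (∑ i ∈ s, g i).toCLM = ∑ i ∈ s, (g i).toCLM := fun s g =>
      map_sum (⟨⟨CB.toCLM, rfl⟩, fun _ _ => rfl⟩ : CB L E →+ (L →L[ℂ] E)) g s
    have hy : f y = ∑ i, f (Module.finBasis ℂ L i) * (Module.finBasis ℂ L).coord i y := by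
      conv_lhs => rw [← (Module.finBasis ℂ L).sum_repr y]
      rw [map_sum]
      simp only [map_smul, smul_eq_mul, Module.Basis.coord_apply]
      exact Finset.sum_congr rfl fun i _ => mul_comm _ _
    simp only [sum_apply, smul_apply, hs, CB.toCLM_smul]
    simp only [CB.tmul, LinearMap.mkContinuous_apply, LinearMap.coe_mk, AddHom.coe_mk,
      ContinuousLinearMap.smulRight_apply, hy, Finset.sum_smul, mul_smul]
    rfl
  rw [key]
  simp only [natMap, sum_apply, ContinuousLinearMap.comp_apply,
    ContinuousLinearMap.comp_finsetSum, ContinuousLinearMap.comp_smul, map_sum, map_smul]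
  rfl

end CB

/-- `E` is locally reflexive (with constant `1`): for each finite-dimensional operator space `L`,
the natural map `CB(L, E**) → CB(L, E)**` is isometric. -/
def LocallyReflexive (E : Type u) [NormedAddCommGroup E] [NormedSpace ℂ E]
    [OperatorSpace E] : Prop :=
  ∀ (L : Type u) [NormedAddCommGroup L] [NormedSpace ℂ L] [OperatorSpace L]
    [FiniteDimensional ℂ L] (u : CB L (StrongDual ℂ (StrongDual ℂ E))), ‖natMap u‖ = ‖u‖

/-! ### Operator ideal norms and the approximation property -/

/-- An operator ideal norm on completely bounded maps between operator spaces. The value `∞`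
is allowed (it marks the maps outside the ideal). -/
structure OperatorIdealNorm where
  toFun : ∀ {E F : Type u} [NormedAddCommGroup E] [NormedSpace ℂ E] [OperatorSpace E]
    [NormedAddCommGroup F] [NormedSpace ℂ F] [OperatorSpace F], CB E F → ℝ≥0∞
  cbNorm_le : ∀ {E F : Type u} [NormedAddCommGroup E] [NormedSpace ℂ E] [OperatorSpace E]
    [NormedAddCommGroup F] [NormedSpace ℂ F] [OperatorSpace F] (T : CB E F),
    ENNReal.ofReal ‖T‖ ≤ toFun T
  add_le : ∀ {E F : Type u} [NormedAddCommGroup E] [NormedSpace ℂ E] [OperatorSpace E]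
    [NormedAddCommGroup F] [NormedSpace ℂ F] [OperatorSpace F] (S T : CB E F),
    toFun (S + T) ≤ toFun S + toFun T
  smul : ∀ {E F : Type u} [NormedAddCommGroup E] [NormedSpace ℂ E] [OperatorSpace E]
    [NormedAddCommGroup F] [NormedSpace ℂ F] [OperatorSpace F] (c : ℂ) (T : CB E F),
    toFun (c • T) = ENNReal.ofReal ‖c‖ * toFun T
  comp_le : ∀ {D E F G : Type u}
    [NormedAddCommGroup D] [NormedSpace ℂ D] [OperatorSpace D]
    [NormedAddCommGroup E] [NormedSpace ℂ E] [OperatorSpace E]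
    [NormedAddCommGroup F] [NormedSpace ℂ F] [OperatorSpace F]
    [NormedAddCommGroup G] [NormedSpace ℂ G] [OperatorSpace G]
    (R : CB F G) (T : CB E F) (S : CB D E),
    toFun (R.comp (T.comp S)) ≤ ENNReal.ofReal ‖R‖ * toFun T * ENNReal.ofReal ‖S‖

namespace OperatorIdealNorm

/-- The dual ideal norm `α^d(T) = α(T*)`. -/
def dual (α : OperatorIdealNorm.{u}) {E F : Type u}
    [NormedAddCommGroup E] [NormedSpace ℂ E] [OperatorSpace E]
    [NormedAddCommGroup F] [NormedSpace ℂ F] [OperatorSpace F] (T : CB E F) : ℝ≥0∞ :=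
  α.toFun T.adjoint

/-- `α` is 1-injective: `α(T) = α(i ∘ T)` for every completely isometric inclusion `i`. -/
def IsOneInjective (α : OperatorIdealNorm.{u}) : Prop :=
  ∀ {E F G : Type u} [NormedAddCommGroup E] [NormedSpace ℂ E] [OperatorSpace E]
    [NormedAddCommGroup F] [NormedSpace ℂ F] [OperatorSpace F]
    [NormedAddCommGroup G] [NormedSpace ℂ G] [OperatorSpace G]
    (T : CB E F) (i : CB F G), i.IsCompleteIsometry → α.toFun T = α.toFun (i.comp T)

end OperatorIdealNorm

/-- The `(K, k(n))`-`α`-OUAP of `E`, for a gauge `α` on `CB(E)`. -/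
def HasOUAP (E : Type u) [NormedAddCommGroup E] [NormedSpace ℂ E] [OperatorSpace E]
    (α : CB E E → ℝ≥0∞) (K : ℝ≥0) (k : ℕ → ℝ≥0) : Prop :=
  1 ≤ K ∧ ∀ (n : ℕ) (M : Submodule ℂ E), FiniteDimensional ℂ M → Module.finrank ℂ M = n →
    ∃ T : CB E E, T.IsFiniteRank ∧ ‖T‖ ≤ K ∧ α T ≤ k n ∧ ∀ x ∈ M, T.toCLM x = x

end OpSpace

end

noncomputable section

namespace OpSpace

open scoped Matrix.Norms.L2Operator
open OperatorSpace

/-! ### Subspaces of operator spaces -/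

/-! Let S be a finite rank map on E* that fixes given functionals f_i, and let ι : E → E** be the
canonical map. Then S*ι takes values in the finite-dimensional subspace V = ran S* of E** and
satisfies (S*ι x)(f_i) = f_i(x). Regarded as a map E → V it still has ideal norm at most α(S*): this
is where 1-injectivity enters. Local reflexivity replaces the inclusion V → E** by a map u : V → E
of almost the same c.b. norm, and T = u ∘ S*ι is a finite rank map on E with the right bounds
(`exists_predual_map`).

The map u is made to satisfy only one scalar equation, ∑ f_i(T x_i) = ∑ f_i(x_i), and depends on the
f_i. Since the admissible maps form a convex set, Hahn–Banach separation in E^n turns these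
equations into one T with T x_i close to x_i for all i (`exists_norm_sub_lt`).

For x_i a basis of M, the error is removed exactly by adding ∑ p_i ⊗ (x_i - T x_i), with p_i
biorthogonal to x_i. This correction is small in c.b. norm, and also in α, because an ideal norm
finite at one nonzero map is finite on rank one maps, linearly in the vector (`exists_tmul_le`). -/

/-- A complete subspace of an operator space inherits the matrix norms. -/
abbrev subspaceStructure {E : Type u} [NormedAddCommGroup E] [NormedSpace ℂ E] [OperatorSpace E]
    (V : Submodule ℂ E) [CompleteSpace V] : OperatorSpace V where
  matNorm n x := matNorm n (x.map V.subtype)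
  matNorm_one x := matNorm_one (x : E)
  matNorm_add_le n x y := by
    rw [Matrix.map_add _ (map_add _)]
    exact matNorm_add_le n _ _
  matNorm_smul n c x := by
    rw [Matrix.map_smul _ _ (map_smul V.subtype c)]
    exact matNorm_smul n c _
  eq_zero_of_matNorm n x hx := by
    have h := eq_zero_of_matNorm n _ hx
    ext i j
    exact congrFun (congrFun h i) j
  matNorm_sandwich_le m n a x b := by
    have h : (sandwich a x b).map V.subtype = sandwich a (x.map V.subtype) b := by
      ext i j
      simp [sandwich]
    rw [h]
    exact matNorm_sandwich_le m n a _ b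
  matNorm_directSum m n x y := by
    have h : (directSum x y).map V.subtype = directSum (x.map V.subtype) (y.map V.subtype) := by
      ext i j
      refine Fin.addCases (fun i => ?_) (fun i => ?_) i <;>
      refine Fin.addCases (fun j => ?_) (fun j => ?_) j <;>
      simp [directSum]
    rw [h]
    exact matNorm_directSum m n _ _

/-! ### Completely bounded maps: composition, adjoint, canonical map into the bidual, evaluation. -/

namespace CB

variable {E F G : Type u} [NormedAddCommGroup E] [NormedSpace ℂ E] [OperatorSpace E]
  [NormedAddCommGroup F] [NormedSpace ℂ F] [OperatorSpace F]
  [NormedAddCommGroup G] [NormedSpace ℂ G] [OperatorSpace G]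

theorem CBBound_of_isometry {T : E →L[ℂ] F}
    (h : ∀ (n : ℕ) (x : Matrix (Fin n) (Fin n) E), matNorm n (x.map T) = matNorm n x) :
    CBBound T 1 := fun n x => by rw [h, one_mul]

variable (E) in
/-- The identity map. -/
def idMap : CB E E :=
  ⟨ContinuousLinearMap.id ℂ E, 1, zero_le_one, CBBound_of_isometry fun _ _ => rfl⟩

theorem norm_idMap_le : ‖idMap E‖ ≤ 1 :=
  cbNorm_le zero_le_one (CBBound_of_isometry fun _ _ => rfl)

theorem norm_comp_le (S : CB F G) (T : CB E F) : ‖S.comp T‖ ≤ ‖S‖ * ‖T‖ := by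
  refine cbNorm_le (mul_nonneg S.cbNorm_nonneg T.cbNorm_nonneg) fun n x => ?_
  rw [mul_assoc]
  exact (S.bound n (x.map T.toCLM)).trans
    (mul_le_mul_of_nonneg_left (T.bound n x) S.cbNorm_nonneg)

theorem norm_adjoint_le (T : CB E F) : ‖T.adjoint‖ ≤ ‖T‖ := by
  refine cbNorm_le T.cbNorm_nonneg fun n f => ?_
  refine dualMatNorm_le _ (mul_nonneg T.cbNorm_nonneg (matNorm_nonneg n f)) fun m x => ?_
  have h : pairing (f.map T.adjoint.toCLM) x = pairing f (x.map T.toCLM) := rfl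
  rw [h]
  calc ‖pairing f (x.map T.toCLM)‖ ≤ matNorm n f * matNorm m (x.map T.toCLM) := pairing_le f _
    _ ≤ matNorm n f * (‖T‖ * matNorm m x) :=
      mul_le_mul_of_nonneg_left (T.bound m x) (matNorm_nonneg n f)
    _ = _ := by ring

/-- Pairing the image of x with f gives the pairing of f with x after exchanging the two tensor
factors. This exchange permutes coordinates and preserves Euclidean norms. -/
theorem CBBound_inclusionInDoubleDual :
    CBBound (F := StrongDual ℂ (StrongDual ℂ E)) (NormedSpace.inclusionInDoubleDual ℂ E) 1 :=
      fun n x => by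
  rw [one_mul]
  refine dualMatNorm_le _ (matNorm_nonneg n x) fun m f => ?_
  have hC : 0 ≤ matNorm n x * matNorm m f := mul_nonneg (matNorm_nonneg n x) (matNorm_nonneg m f)
  have hnv : ∀ v : Fin n × Fin m → ℂ, nv (fun p : Fin m × Fin n => v (p.2, p.1)) = nv v := by
    intro v
    refine (sq_eq_sq₀ (nv_nonneg _) (nv_nonneg _)).1 ?_
    rw [nv_sq, nv_sq, Fintype.sum_prod_type, Fintype.sum_prod_type, Finset.sum_comm]
  refine norm_le_of_mulVec _ hC fun v => ?_
  have h := nv_mulVec_le (pairing f x) fun p => v (p.2, p.1)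
  have hv : (pairing f x).mulVec (fun p => v (p.2, p.1)) = fun p =>
      (pairing (x.map (NormedSpace.inclusionInDoubleDual ℂ E)) f).mulVec v (p.2, p.1) := by
    ext ⟨i, k⟩
    simp only [Matrix.mulVec, dotProduct, Fintype.sum_prod_type, pairing, Matrix.of_apply,
      Matrix.map_apply, NormedSpace.dual_def]
    exact Finset.sum_comm
  rw [hv, hnv, hnv] at h
  refine h.trans (mul_le_mul_of_nonneg_right ?_ (nv_nonneg v))
  rw [mul_comm]
  exact pairing_le f x

variable (E) in
/-- The canonical completely contractive map `E → E**`. -/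
def bidualMap : CB E (StrongDual ℂ (StrongDual ℂ E)) :=
  ⟨NormedSpace.inclusionInDoubleDual ℂ E, 1, zero_le_one, CBBound_inclusionInDoubleDual⟩

theorem norm_bidualMap_le : ‖bidualMap E‖ ≤ 1 :=
  cbNorm_le zero_le_one CBBound_inclusionInDoubleDual

/-- Evaluation at a point, as a bounded map on `CB(E, F)`. -/
def eval (x : E) : CB E F →L[ℂ] F :=
  LinearMap.mkContinuous
    { toFun := fun T => T.toCLM x
      map_add' := fun _ _ => rfl
      map_smul' := fun _ _ => rfl }
    ‖x‖ fun T => (T.le_norm x).trans_eq (mul_comm _ _)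

@[simp] theorem eval_apply (x : E) (T : CB E F) : eval x T = T.toCLM x := rfl

@[simp] theorem tmul_toCLM_apply (f : StrongDual ℂ E) (y : F) (x : E) :
    (tmul F f y).toCLM x = f x • y := rfl

theorem norm_tmul_le (f : StrongDual ℂ E) (y : F) : ‖tmul F f y‖ ≤ ‖f‖ * ‖y‖ :=
  cbNorm_le (by positivity) (CBBound_smulRight f y)

theorem sum_toCLM_apply {ι : Type*} (s : Finset ι) (T : ι → CB E F) (x : E) :
    (∑ i ∈ s, T i).toCLM x = ∑ i ∈ s, (T i).toCLM x :=
  map_sum (eval x : CB E F →L[ℂ] F) T s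

/-! ### Finite rank maps. -/

theorem IsFiniteRank.of_range_le {T : CB E F} {V : Submodule ℂ F} [FiniteDimensional ℂ V]
    (h : ∀ x, T.toCLM x ∈ V) : T.IsFiniteRank :=
  Submodule.finiteDimensional_of_le (S₂ := V) (by rintro _ ⟨x, rfl⟩; exact h x)

theorem isFiniteRank_zero : (0 : CB E F).IsFiniteRank :=
  IsFiniteRank.of_range_le (V := ⊥) fun _ => rfl

theorem IsFiniteRank.add {S T : CB E F} (hS : S.IsFiniteRank) (hT : T.IsFiniteRank) :
    (S + T).IsFiniteRank := by
  unfold IsFiniteRank at hS hT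
  exact IsFiniteRank.of_range_le fun x =>
    Submodule.add_mem_sup (LinearMap.mem_range_self S.toCLM.toLinearMap x)
      (LinearMap.mem_range_self T.toCLM.toLinearMap x)

theorem IsFiniteRank.smul {T : CB E F} (c : ℂ) (hT : T.IsFiniteRank) : (c • T).IsFiniteRank := by
  unfold IsFiniteRank at hT
  exact IsFiniteRank.of_range_le fun x =>
    Submodule.smul_mem _ c (LinearMap.mem_range_self T.toCLM.toLinearMap x)

theorem isFiniteRank_tmul (f : StrongDual ℂ E) (y : F) : (tmul F f y).IsFiniteRank :=
  IsFiniteRank.of_range_le (V := Submodule.span ℂ {y}) fun _ =>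
    Submodule.smul_mem _ _ (Submodule.mem_span_singleton_self y)

theorem isFiniteRank_sum {ι : Type*} (s : Finset ι) (T : ι → CB E F)
    (h : ∀ i ∈ s, (T i).IsFiniteRank) : (∑ i ∈ s, T i).IsFiniteRank :=
  Finset.sum_induction T IsFiniteRank (fun _ _ => IsFiniteRank.add) isFiniteRank_zero h

/-- T factors through its range, so T* factors through the dual of that finite-dimensional space. -/
theorem IsFiniteRank.adjoint {T : CB E F} (hT : T.IsFiniteRank) : T.adjoint.IsFiniteRank := by
  unfold IsFiniteRank at hT
  let r : E →L[ℂ] LinearMap.range (T.toCLM : E →ₗ[ℂ] F) :=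
    T.toCLM.codRestrict _ fun x => ⟨x, rfl⟩
  exact IsFiniteRank.of_range_le
    (V := LinearMap.range (ContinuousLinearMap.precomp ℂ r).toLinearMap) fun f =>
      ⟨f.comp (Submodule.subtypeL _), rfl⟩

/-! ### Local reflexivity -/

/-- The functionals v ↦ f(v z) on CB(L, E) are the ones for which the natural map is used. Expanding
z in the basis shows that its value there does not depend on the basis. -/
theorem natMap_comp_eval {L : Type u} [NormedAddCommGroup L] [NormedSpace ℂ L] [OperatorSpace L]
    [FiniteDimensional ℂ L] (u : CB L (StrongDual ℂ (StrongDual ℂ E))) (f : StrongDual ℂ E)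
    (z : L) : natMap u (f.comp (eval z)) = u.toCLM z f := by
  conv_rhs => rw [← (Module.finBasis ℂ L).sum_repr z]
  simp only [natMap, map_sum, map_smul, sum_apply, ContinuousLinearMap.comp_apply, smul_apply]
  refine Finset.sum_congr rfl fun i _ => ?_
  rw [← map_smul]
  congr 1
  ext x
  simp

end CB

/-- Helly's lemma for a single functional: rescale a vector at which φ nearly attains its norm. The
room between ‖Φ‖ and C makes the equality exact. -/
theorem exists_norm_le_apply_eq {X : Type*} [NormedAddCommGroup X] [NormedSpace ℂ X]
    (Φ : StrongDual ℂ (StrongDual ℂ X)) (φ : StrongDual ℂ X) {C : ℝ} (hC : ‖Φ‖ < C) :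
    ∃ u : X, ‖u‖ ≤ C ∧ φ u = Φ φ := by
  have hC0 : 0 < C := (norm_nonneg Φ).trans_lt hC
  rcases eq_or_ne (Φ φ) 0 with h0 | h0
  · exact ⟨0, by simpa using hC0.le, by simp [h0]⟩
  have hφ : 0 < ‖φ‖ := norm_pos_iff.2 fun h => h0 (by simp [h])
  -- Strict because |Φ φ| ≤ ‖Φ‖ ‖φ‖ < C ‖φ‖; hence some x satisfies |Φ φ| ‖x‖ < C |φ x|.
  have hlt : ‖Φ φ‖ / C < ‖φ‖ := by
    rw [div_lt_iff₀ hC0]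
    nlinarith [Φ.le_opNorm φ]
  obtain ⟨x, hx⟩ : ∃ x, ‖Φ φ‖ / C * ‖x‖ < ‖φ x‖ := by
    by_contra! h
    exact hlt.not_ge (φ.opNorm_le_bound (by positivity) h)
  have hx0 : 0 < ‖φ x‖ := lt_of_le_of_lt (by positivity) hx
  refine ⟨(Φ φ / φ x) • x, ?_, ?_⟩
  · rw [norm_smul, norm_div, div_mul_eq_mul_div, div_le_iff₀ hx0]
    rw [div_mul_eq_mul_div, div_lt_iff₀ hC0] at hx
    linarith
  · rw [map_smul, smul_eq_mul, div_mul_cancel₀ _ (norm_pos_iff.1 hx0)]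

/-- The conclusion concerns one functional on CB(L, E), the sum of v ↦ f_i(v z_i), so the
one-functional Helly lemma applies to `natMap j`, whose norm is ‖j‖ by local reflexivity. -/
theorem LocallyReflexive.exists_lift {E : Type u} [NormedAddCommGroup E] [NormedSpace ℂ E]
    [OperatorSpace E] (hE : LocallyReflexive E) {L : Type u} [NormedAddCommGroup L]
    [NormedSpace ℂ L] [OperatorSpace L] [FiniteDimensional ℂ L]
    (j : CB L (StrongDual ℂ (StrongDual ℂ E))) {C : ℝ} (hC : ‖j‖ < C) {n : ℕ}
    (f : Fin n → StrongDual ℂ E) (z : Fin n → L) :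
    ∃ u : CB L E, ‖u‖ ≤ C ∧ ∑ i, f i (u.toCLM (z i)) = ∑ i, j.toCLM (z i) (f i) := by
  obtain ⟨u, hu, h⟩ := exists_norm_le_apply_eq (natMap j)
    (∑ i, (f i).comp (CB.eval (z i))) (C := C) (by rwa [hE L j])
  refine ⟨u, hu, ?_⟩
  simpa [CB.natMap_comp_eval] using h

/-! ### Consequences of the ideal axioms. -/

namespace OperatorIdealNorm

variable (α : OperatorIdealNorm.{u}) {E F G H : Type u}
  [NormedAddCommGroup E] [NormedSpace ℂ E] [OperatorSpace E]
  [NormedAddCommGroup F] [NormedSpace ℂ F] [OperatorSpace F]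
  [NormedAddCommGroup G] [NormedSpace ℂ G] [OperatorSpace G]
  [NormedAddCommGroup H] [NormedSpace ℂ H] [OperatorSpace H]

theorem zero : α.toFun (0 : CB E F) = 0 := by
  simpa using α.smul 0 (0 : CB E F)

theorem sum_le {ι : Type*} (s : Finset ι) (T : ι → CB E F) :
    α.toFun (∑ i ∈ s, T i) ≤ ∑ i ∈ s, α.toFun (T i) :=
  Finset.le_sum_of_subadditive _ α.zero.le α.add_le s T

theorem comp_left_le (R : CB F G) (T : CB E F) :
    α.toFun (R.comp T) ≤ ENNReal.ofReal ‖R‖ * α.toFun T := by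
  refine (α.comp_le R T (CB.idMap E)).trans ?_
  refine mul_le_of_le_one_right' ?_
  exact ENNReal.ofReal_le_one.2 CB.norm_idMap_le

theorem comp_right_le (T : CB F G) (S : CB E F) :
    α.toFun (T.comp S) ≤ α.toFun T * ENNReal.ofReal ‖S‖ := by
  refine (α.comp_le (CB.idMap G) T S).trans ?_
  gcongr
  refine mul_le_of_le_one_left' ?_
  exact ENNReal.ofReal_le_one.2 CB.norm_idMap_le

/-- An ideal norm which is finite on some nonzero map is finite on all rank one maps. -/
theorem exists_tmul_le {A : CB G H} (hA : A ≠ 0) (hα : α.toFun A ≠ ∞) (f : StrongDual ℂ E) :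
    ∃ C : ℝ≥0, ∀ y : F, α.toFun (CB.tmul F f y) ≤ C * ENNReal.ofReal ‖y‖ := by
  obtain ⟨z, hz⟩ : ∃ z, A.toCLM z ≠ 0 := by
    by_contra! h
    exact hA (CB.toCLM_injective (ContinuousLinearMap.ext h))
  obtain ⟨g, hg⟩ := SeparatingDual.exists_eq_one (R := ℂ) hz
  refine ⟨‖g‖₊ * (α.toFun A).toNNReal * ‖CB.tmul G f z‖₊, fun y => ?_⟩
  -- With g(Az) = 1, every f ⊗ y factors through A, and y enters only through the left factor; hence
  -- a constant independent of y.
  have h : CB.tmul F f y = (CB.tmul F g y).comp (A.comp (CB.tmul G f z)) := by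
    apply CB.toCLM_injective
    ext x
    simp [CB.comp, hg]
  rw [h]
  refine (α.comp_le _ _ _).trans ?_
  have h1 : ENNReal.ofReal ‖CB.tmul F g y‖ ≤ ‖g‖₊ * ENNReal.ofReal ‖y‖ := by
    refine (ENNReal.ofReal_le_ofReal (CB.norm_tmul_le g y)).trans_eq ?_
    rw [ENNReal.ofReal_mul (norm_nonneg _), ofReal_norm, enorm_eq_nnnorm]
  rw [ofReal_norm (CB.tmul G f z), enorm_eq_nnnorm]
  push_cast
  rw [ENNReal.coe_toNNReal hα]
  calc _ ≤ (‖g‖₊ * ENNReal.ofReal ‖y‖) * α.toFun A * ‖CB.tmul G f z‖₊ := by gcongr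
    _ = _ := by ring

end OperatorIdealNorm

/-! ### Transfer of approximating maps -/

/-- The approximation property is stated for subspaces of dimension exactly n, and k need not be
monotone, so a smaller subspace has to be enlarged. While dim N < n some p_i lies outside N, and
adjoining it raises the dimension by one. -/
theorem exists_submodule_finrank_eq {X : Type*} [AddCommGroup X] [Module ℂ X] {n : ℕ}
    {p : Fin n → X} (hp : LinearIndependent ℂ p) (N : Submodule ℂ X) [FiniteDimensional ℂ N]
    (hN : Module.finrank ℂ N ≤ n) :
    ∃ V : Submodule ℂ X, N ≤ V ∧ FiniteDimensional ℂ V ∧ Module.finrank ℂ V = n := by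
  obtain ⟨d, hd⟩ := Nat.exists_eq_add_of_le hN
  induction d generalizing N with
  | zero => exact ⟨N, le_rfl, inferInstance, hd.symm⟩
  | succ d ih =>
    obtain ⟨i, hi⟩ : ∃ i, p i ∉ N := by
      by_contra! h
      have h1 := Submodule.finrank_mono (Submodule.span_le.2 (Set.range_subset_iff.2 h))
      rw [finrank_span_eq_card hp, Fintype.card_fin] at h1
      omega
    have h1 := Submodule.finrank_lt_finrank_of_lt (left_lt_sup.2 (by simpa using hi) :
      N < N ⊔ Submodule.span ℂ {p i})
    have h2 := Submodule.finrank_add_le_finrank_add_finrank N (Submodule.span ℂ {p i})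
    have h3 := finrank_span_le_card (R := ℂ) ({p i} : Set X)
    simp only [Set.toFinset_card, Fintype.card_unique] at h3
    obtain ⟨V, hV⟩ := ih (N ⊔ Submodule.span ℂ {p i}) (by omega) (by omega)
    exact ⟨V, le_sup_left.trans hV.1, hV.2⟩

/-- Coordinate functionals extended through a bounded projection onto M. -/
theorem exists_biorthogonal {E : Type*} [NormedAddCommGroup E] [NormedSpace ℂ E]
    {M : Submodule ℂ E} [FiniteDimensional ℂ M] {n : ℕ} (b : Module.Basis (Fin n) ℂ M) :
    ∃ p : Fin n → StrongDual ℂ E, ∀ y : M, ∀ i, p i y = b.repr y i := by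
  obtain ⟨P, hP⟩ := Submodule.ClosedComplemented.of_finiteDimensional M
  exact ⟨fun i => (LinearMap.toContinuousLinearMap (b.coord i)).comp P, fun y i => by simp [hP]⟩

/-- If some map on `E*` fixes the functionals `f_i`, then a map on the locally reflexive space `E`
agrees with the identity as far as `∑ f_i(x_i)` is concerned. -/
theorem exists_predual_map (α : OperatorIdealNorm.{u}) (hα : α.IsOneInjective)
    {E : Type u} [NormedAddCommGroup E] [NormedSpace ℂ E] [OperatorSpace E]
    (hE : LocallyReflexive E) (S : CB (StrongDual ℂ E) (StrongDual ℂ E)) (hS : S.IsFiniteRank)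
    {n : ℕ} (f : Fin n → StrongDual ℂ E) (hf : ∀ i, S.toCLM (f i) = f i) (x : Fin n → E)
    {C : ℝ} (hC : 1 < C) :
    ∃ T : CB E E, T.IsFiniteRank ∧ ‖T‖ ≤ C * ‖S‖ ∧ α.toFun T ≤ ENNReal.ofReal C * α.dual S ∧
      ∑ i, f i (T.toCLM (x i)) = ∑ i, f i (x i) := by
  let V := LinearMap.range S.adjoint.toCLM.toLinearMap
  have : FiniteDimensional ℂ V := hS.adjoint
  have : CompleteSpace V := FiniteDimensional.complete ℂ V
  let : OperatorSpace V := subspaceStructure V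
  let j : CB V (StrongDual ℂ (StrongDual ℂ E)) :=
    ⟨V.subtypeL, 1, zero_le_one, CB.CBBound_of_isometry fun _ _ => rfl⟩
  have hj : j.IsCompleteIsometry := fun _ _ => rfl
  have hj1 : ‖j‖ ≤ 1 := CB.cbNorm_le zero_le_one (CB.CBBound_of_isometry hj)
  let R := S.adjoint.comp (CB.bidualMap E)
  have hR : ‖R‖ ≤ ‖S‖ := by
    refine (CB.norm_comp_le _ _).trans ?_
    nlinarith [S.norm_adjoint_le, CB.norm_bidualMap_le (E := E), norm_nonneg S.adjoint]
  -- `R` with codomain cut down to V. The matrix norms of V are inherited, so the bounds of `R`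
  -- carry over verbatim.
  let T₀ : CB E V := ⟨R.toCLM.codRestrict V fun y => ⟨_, rfl⟩, ‖R‖, norm_nonneg R, R.bound⟩
  have hT₀ : ‖T₀‖ ≤ ‖S‖ := (CB.cbNorm_le (norm_nonneg R) R.bound).trans hR
  have hjT : j.comp T₀ = R := rfl
  have hαT : α.toFun T₀ ≤ α.dual S := by
    -- The use of 1-injectivity: restricting the codomain from E** to V does not increase α.
    rw [hα T₀ j hj, hjT]
    refine (α.comp_right_le S.adjoint (CB.bidualMap E)).trans (mul_le_of_le_one_right' ?_)
    exact ENNReal.ofReal_le_one.2 CB.norm_bidualMap_le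
  obtain ⟨u, hu, hfu⟩ := hE.exists_lift j (hj1.trans_lt hC) f fun i => T₀.toCLM (x i)
  refine ⟨u.comp T₀, ?_, ?_, ?_, ?_⟩
  · exact CB.IsFiniteRank.of_range_le (V := LinearMap.range u.toCLM.toLinearMap) fun y => ⟨_, rfl⟩
  · exact (CB.norm_comp_le _ _).trans (mul_le_mul hu hT₀ (norm_nonneg _) (by linarith))
  · exact (α.comp_left_le u T₀).trans (mul_le_mul' (ENNReal.ofReal_le_ofReal hu) hαT)
  · refine hfu.trans (Finset.sum_congr rfl fun i _ => ?_)
    -- Unfolds to (S*ι x_i)(f_i) = (S f_i)(x_i) = f_i(x_i).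
    exact congrArg (fun g : StrongDual ℂ E => g (x i)) (hf i)

/-- A convex family of finite rank maps which meets all finite sets of linear constraints
approximates the identity on finitely many points. -/
theorem exists_norm_sub_lt (α : OperatorIdealNorm.{u})
    {E : Type u} [NormedAddCommGroup E] [NormedSpace ℂ E] [OperatorSpace E] {n : ℕ}
    (x : Fin n → E) (C : ℝ) (D : ℝ≥0∞)
    (h : ∀ f : Fin n → StrongDual ℂ E, ∃ T : CB E E, T.IsFiniteRank ∧ ‖T‖ ≤ C ∧ α.toFun T ≤ D ∧
      ∑ i, f i (T.toCLM (x i)) = ∑ i, f i (x i)) {δ : ℝ} (hδ : 0 < δ) :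
    ∃ T : CB E E, T.IsFiniteRank ∧ ‖T‖ ≤ C ∧ α.toFun T ≤ D ∧
      ∀ i, ‖x i - T.toCLM (x i)‖ < δ := by
  let s : Set (Fin n → E) := {y | ∃ T : CB E E, T.IsFiniteRank ∧ ‖T‖ ≤ C ∧ α.toFun T ≤ D ∧
    ∀ i, T.toCLM (x i) = y i}
  have hs : Convex ℝ s := by
    rintro y ⟨T, hT1, hT2, hT3, hT4⟩ y' ⟨T', hT1', hT2', hT3', hT4'⟩ a b ha hb hab
    have hna : ‖(a : ℂ)‖ = a := by simp [abs_of_nonneg ha]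
    have hnb : ‖(b : ℂ)‖ = b := by simp [abs_of_nonneg hb]
    refine ⟨(a : ℂ) • T + (b : ℂ) • T', (hT1.smul _).add (hT1'.smul _), ?_, ?_, fun i => ?_⟩
    · refine (norm_add_le _ _).trans ?_
      rw [norm_smul, norm_smul, hna, hnb]
      calc a * ‖T‖ + b * ‖T'‖ ≤ a * C + b * C := by gcongr
        _ = C := by rw [← add_mul, hab, one_mul]
    · refine (α.add_le _ _).trans ?_
      rw [α.smul, α.smul, hna, hnb]
      calc _ ≤ ENNReal.ofReal a * D + ENNReal.ofReal b * D := by gcongr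
        _ = D := by rw [← add_mul, ← ENNReal.ofReal_add ha hb, hab, ENNReal.ofReal_one, one_mul]
    · rw [CB.toCLM_add, CB.toCLM_smul, CB.toCLM_smul, add_apply, smul_apply, smul_apply, hT4, hT4']
      rfl
  have hx : x ∈ closure s := by
    by_contra hx
    -- A functional g on E^n that separates x from the closure of s has coordinates f_i; the map T
    -- supplied for these f_i gives a point of s on which g takes the value g(x).
    obtain ⟨g, r, hg, hgx⟩ := RCLike.geometric_hahn_banach_closed_point (𝕜 := ℂ) hs.closure
      isClosed_closure hx
    have hsum : ∀ y, g y = ∑ i, (g.comp (ContinuousLinearMap.single ℂ (fun _ => E) i)) (y i) := by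
      intro y
      conv_lhs => rw [← Finset.univ_sum_single y]
      rw [map_sum]
      rfl
    obtain ⟨T, hT1, hT2, hT3, hT4⟩ :=
      h fun i => g.comp (ContinuousLinearMap.single ℂ (fun _ => E) i)
    have := hg _ (subset_closure ⟨T, hT1, hT2, hT3, fun _ => rfl⟩)
    rw [hsum, hT4, ← hsum] at this
    exact lt_asymm this hgx
  obtain ⟨y, ⟨T, hT1, hT2, hT3, hT4⟩, hy⟩ := Metric.mem_closure_iff.1 hx δ hδ
  refine ⟨T, hT1, hT2, hT3, fun i => ?_⟩
  rw [hT4, ← dist_eq_norm]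
  exact (dist_le_pi_dist x y i).trans_lt hy

/-- Dividing by B + 1 allows B = 0. The bound for all smaller η lets two such δ be combined by their
minimum. -/
theorem exists_pos_mul_le {B c : ℝ≥0} (hc : 0 < c) : ∃ δ : ℝ≥0, 0 < δ ∧ ∀ η ≤ δ, B * η ≤ c := by
  refine ⟨c / (B + 1), by positivity, fun η hη => ?_⟩
  calc B * η ≤ (B + 1) * (c / (B + 1)) := by gcongr; exact le_self_add
    _ = c := mul_div_cancel₀ _ (by positivity)

end OpSpace

end

/-! ### Proof of the lemma. -/

open OpSpace in
theorem mainTheorem3 (α : OpSpace.OperatorIdealNorm.{u}) (hα : α.IsOneInjective)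
    {E : Type u} [NormedAddCommGroup E] [NormedSpace ℂ E] [OpSpace.OperatorSpace E]
    (hE : OpSpace.LocallyReflexive E) (K : ℝ≥0) (k : ℕ → ℝ≥0)
    (hOUAP : OpSpace.HasOUAP (StrongDual ℂ E) α.dual K k) (ε : ℝ≥0) (hε : 0 < ε) :
    OpSpace.HasOUAP E α.toFun (K * (1 + ε)) (fun n => k n * (1 + ε)) := by
  obtain ⟨hK, hS⟩ := hOUAP
  refine ⟨one_le_mul hK le_self_add, fun n M hM hn => ?_⟩
  -- For n = 0 the zero map works. No nonzero map of finite α need be at hand then, and k 0 may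
  -- vanish.
  rcases Nat.eq_zero_or_pos n with rfl | hn0
  · refine ⟨0, CB.isFiniteRank_zero, by rw [norm_zero]; exact NNReal.coe_nonneg _, by simp [α.zero], fun x hx => ?_⟩
    rw [Submodule.finrank_eq_zero] at hn
    subst hn
    rw [(Submodule.mem_bot ℂ).1 hx, map_zero]
  let b : Module.Basis (Fin n) ℂ M := Module.finBasisOfFinrankEq ℂ M hn
  obtain ⟨p, hp⟩ := exists_biorthogonal b
  have hpx : ∀ i j, p i (b j) = if j = i then 1 else 0 := fun i j => by
    rw [hp, b.repr_self, Finsupp.single_apply]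
  have hpi : LinearIndependent ℂ p := by
    rw [Fintype.linearIndependent_iff]
    intro g hg j
    simpa [hpx] using congrArg (fun f : StrongDual ℂ E => f (b j)) hg
  -- The f_i may be dependent; their span is enlarged to dimension n by means of the independent
  -- p_i.
  have hSf : ∀ f : Fin n → StrongDual ℂ E, ∃ S : CB (StrongDual ℂ E) (StrongDual ℂ E),
      S.IsFiniteRank ∧ ‖S‖ ≤ K ∧ α.dual S ≤ k n ∧ ∀ i, S.toCLM (f i) = f i := fun f => by
    have := FiniteDimensional.span_of_finite ℂ (Set.finite_range f)
    obtain ⟨V, hfV, hV, hVn⟩ := exists_submodule_finrank_eq hpi (Submodule.span ℂ (Set.range f))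
      ((finrank_range_le_card f).trans_eq (Fintype.card_fin n))
    obtain ⟨S, hS1, hS2, hS3, hS4⟩ := hS n V hV hVn
    exact ⟨S, hS1, hS2, hS3, fun i => hS4 _ (hfV (Submodule.subset_span ⟨i, rfl⟩))⟩
  -- `S₀` fixes p_i ≠ 0, so its adjoint is a nonzero map of finite α. This makes α finite on rank
  -- one maps.
  obtain ⟨S₀, -, -, hαS, hS₀⟩ := hSf p
  have hA : S₀.adjoint ≠ 0 := fun h => by
    have h1 : S₀.toCLM (p ⟨0, hn0⟩) (b ⟨0, hn0⟩) = 0 := congrArg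
      (fun T : CB _ (StrongDual ℂ (StrongDual ℂ E)) =>
        T.toCLM (NormedSpace.inclusionInDoubleDual ℂ E (b ⟨0, hn0⟩)) (p ⟨0, hn0⟩)) h
    rw [hS₀, hpx] at h1
    simp at h1
  -- α dominates the c.b. norm of the nonzero map `S₀.adjoint`. Positivity of k n leaves room k n ·
  -- ε/2 for the correction term.
  have hkn : 0 < k n := by
    have h := (α.cbNorm_le S₀.adjoint).trans hαS
    rw [pos_iff_ne_zero]
    intro h0
    rw [h0] at h
    exact hA (norm_le_zero_iff.1 (by simpa using h))
  choose c hc using fun i => α.exists_tmul_le (F := E) hA (hαS.trans_lt ENNReal.coe_lt_top).ne (p i)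
  have hK0 : 0 < K := one_pos.trans_le hK
  obtain ⟨δ₁, hδ₁, h₁⟩ := exists_pos_mul_le (B := ∑ i, ‖p i‖₊) (c := K * (ε / 2)) (by positivity)
  obtain ⟨δ₂, hδ₂, h₂⟩ := exists_pos_mul_le (B := ∑ i, c i) (c := k n * (ε / 2)) (by positivity)
  let δ := min δ₁ δ₂
  have hδ : 0 < δ := lt_min hδ₁ hδ₂
  -- Half of ε is spent on local reflexivity, with constant 1 + ε/2; the other half pays for the
  -- correction, through the choice of δ.
  obtain ⟨T, hT1, hT2, hT3, hT4⟩ := exists_norm_sub_lt α (fun i => (b i : E))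
    ((K * (1 + ε / 2) : ℝ≥0) : ℝ) ((k n * (1 + ε / 2) : ℝ≥0) : ℝ≥0∞) (fun f => by
      obtain ⟨S, hS1, hS2, hS3, hS4⟩ := hSf f
      obtain ⟨T, hT1, hT2, hT3, hT4⟩ := exists_predual_map α hα hE S hS1 f hS4
        (fun i => (b i : E)) (C := ((1 + ε / 2 : ℝ≥0) : ℝ)) (by push_cast; simpa using hε)
      refine ⟨T, hT1, hT2.trans ?_, hT3.trans ?_, hT4⟩
      · rw [NNReal.coe_mul, mul_comm]
        gcongr
      · rw [ENNReal.ofReal_coe_nnreal, ENNReal.coe_mul, mul_comm]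
        gcongr) (δ := δ) hδ
  -- On y = ∑ p_i(y) b_i the correction adds ∑ p_i(y)(b_i - T b_i), so the sum is exactly y.
  refine ⟨T + ∑ i, CB.tmul E (p i) (b i - T.toCLM (b i)), hT1.add
    (CB.isFiniteRank_sum _ _ fun i _ => CB.isFiniteRank_tmul _ _), ?_, ?_, fun y hy => ?_⟩
  · have h : ‖∑ i, CB.tmul E (p i) (b i - T.toCLM (b i))‖ ≤ ((∑ i, ‖p i‖₊) * δ : ℝ≥0) := by
      push_cast
      rw [Finset.sum_mul]
      refine norm_sum_le_of_le _ fun i _ => (CB.norm_tmul_le _ _).trans ?_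
      exact mul_le_mul_of_nonneg_left (hT4 i).le (norm_nonneg _)
    refine (norm_add_le _ _).trans ((add_le_add hT2 (h.trans (NNReal.coe_le_coe.2 (h₁ δ (min_le_left _ _))))).trans_eq ?_)
    push_cast
    ring
  · have h : α.toFun (∑ i, CB.tmul E (p i) (b i - T.toCLM (b i))) ≤ ((∑ i, c i) * δ : ℝ≥0) := by
      push_cast
      rw [Finset.sum_mul]
      refine (α.sum_le _ _).trans (Finset.sum_le_sum fun i _ => (hc i _).trans ?_)
      gcongr
      rw [← ENNReal.ofReal_coe_nnreal]
      exact ENNReal.ofReal_le_ofReal (hT4 i).le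
    refine (α.add_le _ _).trans ((add_le_add hT3
      (h.trans (ENNReal.coe_le_coe.2 (h₂ δ (min_le_right _ _))))).trans_eq ?_)
    norm_cast
    rw [← mul_add, add_assoc, add_halves]
  · have hy' : y = ∑ i, p i y • (b i : E) := by
      have h := congrArg Subtype.val (b.sum_repr ⟨y, hy⟩)
      simpa [← hp] using h.symm
    have h : T.toCLM y = ∑ i, p i y • T.toCLM (b i) := by
      conv_lhs => rw [hy', map_sum]
      simp only [map_smul]
    rw [CB.toCLM_add, add_apply, CB.sum_toCLM_apply, h, ← Finset.sum_add_distrib]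
    simp only [CB.tmul_toCLM_apply, ← smul_add, add_sub_cancel]
    exact hy'.symm
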